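/- All graphs are finite and simple. The chromatic index $\chi'(G)$ is the least $k$ such that the edges of $G$ can be coloured with $k$ colours so that any two distinct edges with a common endpoint get different colours, and $\Delta(G)$ is the maximum degree. The chromatic vertex stability number $vs_{\chi'}(G)$ of a graph $G$ with at least one edge is the minimum number of vertices of $G$ whose removal results in a graph $H$ with $\chi'(H)\neq\chi'(G)$; if $G$ has no edges, then $vs_{\chi'}(G)=0$. The join $G_1\vee G_2$ is obtained from the disjoint union of $G_1$ and $G_2$ by adding all edges $uv$ with $u\in V(G_1)$ and $v\in V(G_2)$. Theorem. Let $G=G_1\vee G_2$, and let $n_i=|V(G_i)|$ and $\Delta_i=\Delta(G_i)$ for $i=1,2$. (i) If $n_1\leq n_2-1$ (in particular, if $n_1=n_2-1$) and $\Delta_1>\Delta_2$, then $vs_{\chi'}(G)=1$. (ii) If $n_1=n_2+1$ and $\Delta_1<\Delta_2$, then $vs_{\chi'}(G)=1$. -/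

import Mathlib

namespace SimpleGraph

/-- The join `G₁ ∨ G₂`: the disjoint union of `G₁` and `G₂` together with all edges between a
vertex of `G₁` and a vertex of `G₂`. -/
def graphJoin {V₁ V₂ : Type*} (G₁ : SimpleGraph V₁) (G₂ : SimpleGraph V₂) :
    SimpleGraph (V₁ ⊕ V₂) :=
  (G₁ ⊕g G₂) ⊔ completeBipartiteGraph V₁ V₂

/-- The chromatic index `χ'(G)`: the least number of colours in a colouring of the edges in which
any two distinct edges with a common endpoint have different colours, that is, in a proper
colouring of the vertices of the line graph. -/
noncomputable def chromaticIndex {V : Type*} (G : SimpleGraph V) : ℕ∞ :=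
  G.lineGraph.chromaticNumber

open Classical in
/-- The chromatic vertex stability number of a finite graph `G`: the least number of vertices
whose removal changes the chromatic index, and `0` if `G` has no edges. (If `G` has an edge, then
the set below contains `|V|`, since removing all vertices makes the chromatic index `0`.) -/
noncomputable def vertexStabilityChromaticIndex {V : Type*} [Fintype V] (G : SimpleGraph V) : ℕ :=
  if G = ⊥ then 0
  else sInf {k : ℕ | ∃ S : Finset V, S.card = k ∧
    (G.induce {v : V | v ∉ S}).chromaticIndex ≠ G.chromaticIndex}

end SimpleGraph

/-!
Exchanging the two factors of the join turns the second claim into a case of the first, so let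
`n₁ + 1 ≤ n₂` and `Δ₂ < Δ₁`. A vertex of maximum degree of `G₁` has degree `Δ₁ + n₂` in `G₁ ∨ G₂`,
hence the chromatic index of the join is at least `Δ₁ + n₂`. The removal of any vertex `v` of `G₂`
leaves the join of `G₁` with a graph on `m = n₂ - 1 ≥ n₁` vertices that still has smaller maximum
degree than `G₁`, and it suffices to colour the edges of this join with `Δ₁ + m` colours.

That is `chromaticIndex_graphJoin_le`. The complete bipartite graph between the two factors is a
union of `m` matchings, one for each difference in `ZMod m`, and each of them covers `G₁`. One of
them is put together with the two factors to form the graph `matchedSum`, and the remaining ones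
use `m - 1` colours. It remains to colour `matchedSum` with `Δ₁ + 1` colours, although that can be
its maximum degree. By Vizing's theorem `Δ₁ + 1` colours suffice for the disjoint union of the
factors. The matching edges are then added one at a time, each by means of a Vizing fan centred at
its end `w` in `G₂`: all neighbours of `w` in `G₂` have degree at most `Δ₁` in `matchedSum`, so a
colour is missing at each of them, which is all that the fan argument needs
(`PartialEdgeColoring.extendable_of_ncard_neighborSet`). The same extension step proves the case of
Vizing's theorem that is used.
-/

namespace SimpleGraph

/-! ### Partial edge colourings -/

/-- A proper colouring of some of the edges of `G` with colours in `α`. The relation `col z u v`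
says that `uv` is an edge that has received the colour `z`; edges without a colour are allowed. -/
structure PartialEdgeColoring {V : Type*} (G : SimpleGraph V) (α : Type*) where
  /-- `col z u v` means that the edge `uv` has colour `z`. -/
  col : α → V → V → Prop
  symm : ∀ {z u v}, col z u v → col z v u
  adj : ∀ {z u v}, col z u v → G.Adj u v
  unique : ∀ {y z u v}, col y u v → col z u v → y = z
  proper : ∀ {z u v v'}, col z u v → col z u v' → v = v'

namespace PartialEdgeColoring

variable {V α : Type*} {G : SimpleGraph V}

/-- The pair `uv` is an edge that has received a colour. -/
def Colored (C : PartialEdgeColoring G α) (u v : V) : Prop := ∃ z, C.col z u v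

/-- No edge at the vertex `u` has colour `z`. -/
def Misses (C : PartialEdgeColoring G α) (u : V) (z : α) : Prop := ∀ v, ¬ C.col z u v

lemma Colored.symm {C : PartialEdgeColoring G α} {u v : V} (h : C.Colored u v) :
    C.Colored v u :=
  h.imp fun _ => C.symm

/-- Remove the colour of the edge `ab`. -/
def erase (C : PartialEdgeColoring G α) (a b : V) : PartialEdgeColoring G α where
  col z u v := C.col z u v ∧ s(u, v) ≠ s(a, b)
  symm h := ⟨C.symm h.1, by rw [Sym2.eq_swap]; exact h.2⟩
  adj h := C.adj h.1
  unique h h' := C.unique h.1 h'.1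
  proper h h' := C.proper h.1 h'.1

/-- Give the uncoloured edge `ab` a colour missing at both of its ends. -/
def addEdge (C : PartialEdgeColoring G α) {a b : V} {x : α} (hab : G.Adj a b)
    (hc : ¬ C.Colored a b) (ha : C.Misses a x) (hb : C.Misses b x) :
    PartialEdgeColoring G α where
  col z u v := C.col z u v ∨ (z = x ∧ s(u, v) = s(a, b))
  symm h := h.imp C.symm fun h => ⟨h.1, by rw [Sym2.eq_swap]; exact h.2⟩
  adj := by
    rintro z u v (h | ⟨-, h⟩)
    · exact C.adj h
    · rwa [← mem_edgeSet, h]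
  unique := by
    have key : ∀ {z u v}, C.col z u v → s(u, v) ≠ s(a, b) := by
      intro z u v h e
      rcases Sym2.eq_iff.1 e with ⟨rfl, rfl⟩ | ⟨rfl, rfl⟩
      · exact hc ⟨z, h⟩
      · exact hc ⟨z, C.symm h⟩
    rintro y z u v (h | ⟨rfl, h⟩) (h' | ⟨rfl, h'⟩)
    · exact C.unique h h'
    · exact (key h h').elim
    · exact (key h' h).elim
    · rfl
  proper := by
    have key : ∀ {u v v'}, C.col x u v → s(u, v') ≠ s(a, b) := by
      intro u v v' h e
      rcases Sym2.eq_iff.1 e with ⟨rfl, rfl⟩ | ⟨rfl, rfl⟩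
      · exact ha _ h
      · exact hb _ h
    rintro z u v v' (h | ⟨hz, h⟩) (h' | ⟨hz', h'⟩)
    · exact C.proper h h'
    · exact (key (hz' ▸ h) h').elim
    · exact (key (hz ▸ h') h).elim
    · exact Sym2.congr_right.1 (h.trans h'.symm)

lemma colored_addEdge (C : PartialEdgeColoring G α) {a b : V} {x : α} (hab : G.Adj a b)
    (hc : ¬ C.Colored a b) (ha : C.Misses a x) (hb : C.Misses b x) (u v : V) :
    (C.addEdge hab hc ha hb).Colored u v ↔ C.Colored u v ∨ s(u, v) = s(a, b) := by
  simp [Colored, addEdge, exists_or]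

lemma colored_erase (C : PartialEdgeColoring G α) (a b u v : V) :
    (C.erase a b).Colored u v ↔ C.Colored u v ∧ s(u, v) ≠ s(a, b) := by
  simp [Colored, erase]

open Classical in
/-- Interchange the colours `a` and `b` at the vertices of a set `S` that no edge of colour `a`
or `b` leaves. -/
noncomputable def swapOn (C : PartialEdgeColoring G α) (a b : α) (S : Set V)
    (hS : ∀ u v, C.col a u v ∨ C.col b u v → u ∈ S → v ∈ S) : PartialEdgeColoring G α where
  col z u v := C.col (if u ∈ S then Equiv.swap a b z else z) u v
  symm {z u v} h := by
    by_cases hz : z = a ∨ z = b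
    · have : u ∈ S ↔ v ∈ S := by
        have h1 : C.col a u v ∨ C.col b u v := by
          split_ifs at h <;> rcases hz with rfl | rfl <;> simp_all
        exact ⟨hS u v h1, hS v u (h1.imp C.symm C.symm)⟩
      simpa [this] using C.symm h
    · push Not at hz
      rw [Equiv.swap_apply_of_ne_of_ne hz.1 hz.2, ite_self] at h ⊢
      exact C.symm h
  adj h := C.adj h
  unique {y z u v} h h' := by
    have := C.unique h h'
    split_ifs at this
    · exact (Equiv.swap a b).injective this
    · exact this
  proper h h' := C.proper h h'

lemma colored_swapOn (C : PartialEdgeColoring G α) (a b : α) (S : Set V)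
    (hS : ∀ u v, C.col a u v ∨ C.col b u v → u ∈ S → v ∈ S) (u v : V) :
    (C.swapOn a b S hS).Colored u v ↔ C.Colored u v := by
  classical
  by_cases hu : u ∈ S
  · simp only [Colored, swapOn, hu, if_true]
    exact (Equiv.swap a b).exists_congr_left.trans (by simp)
  · simp [Colored, swapOn, hu]

/-! ### Kempe chains -/

/-- The graph of the edges of colour `a` or `b`; its components are the Kempe chains. -/
def kempeGraph (C : PartialEdgeColoring G α) (a b : α) : SimpleGraph V where
  Adj u v := C.col a u v ∨ C.col b u v
  symm := ⟨fun _ _ h => h.imp C.symm C.symm⟩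
  loopless := ⟨fun _ h => h.elim (fun h => (C.adj h).ne rfl) fun h => (C.adj h).ne rfl⟩

lemma ncard_kempeGraph_neighborSet_le [Finite V] (C : PartialEdgeColoring G α) (a b : α) (u : V) :
    ((C.kempeGraph a b).neighborSet u).ncard ≤ 2 := by
  have h : (C.kempeGraph a b).neighborSet u = {v | C.col a u v} ∪ {v | C.col b u v} := rfl
  rw [h]
  have h1 : ∀ z, {v | C.col z u v}.ncard ≤ 1 := fun z =>
    (Set.ncard_le_one_iff (Set.toFinite _)).2 fun h h' => C.proper h h'
  exact (Set.ncard_union_le _ _).trans (add_le_add (h1 a) (h1 b))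

lemma ncard_kempeGraph_neighborSet_le_of_misses [Finite V] (C : PartialEdgeColoring G α) (a b : α)
    (u : V) (hu : C.Misses u a ∨ C.Misses u b) :
    ((C.kempeGraph a b).neighborSet u).ncard ≤ 1 := by
  refine (Set.ncard_le_one_iff (Set.toFinite _)).2 fun {v v'} h h' => ?_
  rcases hu with hu | hu
  · exact C.proper (h.resolve_left (hu _)) (h'.resolve_left (hu _))
  · exact C.proper (h.resolve_right (hu _)) (h'.resolve_right (hu _))

end PartialEdgeColoring

/-- In a graph of maximum degree at most two, no component has three vertices of degree at most
one: a connected graph on `m` vertices has at least `m - 1` edges, so its degrees add up to at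
least `2 * m - 2`. -/
lemma not_reachable_of_ncard_neighborSet_le {V : Type*} [Finite V] {K : SimpleGraph V}
    (h2 : ∀ v, (K.neighborSet v).ncard ≤ 2) {x y z : V} (hxy : x ≠ y) (hxz : x ≠ z) (hyz : y ≠ z)
    (hx : (K.neighborSet x).ncard ≤ 1) (hy : (K.neighborSet y).ncard ≤ 1)
    (hz : (K.neighborSet z).ncard ≤ 1) : ¬ (K.Reachable x y ∧ K.Reachable x z) := by
  classical
  have := Fintype.ofFinite V
  rintro ⟨rxy, rxz⟩
  let c := K.connectedComponentMk x
  have hconn : (K.induce c.supp).Connected := c.connected_toSimpleGraph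
  have hcard := hconn.card_vert_le_card_edgeSet_add_one
  have hsum := (K.induce c.supp).sum_degrees_eq_twice_card_edges
  have hdeg : ∀ v : c.supp, (K.induce c.supp).degree v ≤ (K.neighborSet v).ncard := by
    intro v
    rw [← card_neighborSet_eq_degree, ← Nat.card_eq_fintype_card, ← Nat.card_coe_set_eq]
    exact Nat.card_le_card_of_injective (fun w => ⟨w.1.1, w.2⟩) fun w w' h =>
      Subtype.ext (Subtype.ext (Subtype.mk.inj h))
  have mx : x ∈ c.supp := rfl
  have my : y ∈ c.supp := ConnectedComponent.sound rxy.symm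
  have mz : z ∈ c.supp := ConnectedComponent.sound rxz.symm
  let T : Finset c.supp := {⟨x, mx⟩, ⟨y, my⟩, ⟨z, mz⟩}
  have hT : T.card = 3 := by
    rw [Finset.card_eq_three]
    exact ⟨_, _, _, by simpa using hxy, by simpa using hxz, by simpa using hyz, rfl⟩
  have hle : ∑ v : c.supp, ((K.induce c.supp).degree v + if v ∈ T then 1 else 0)
      ≤ ∑ _v : c.supp, 2 := by
    refine Finset.sum_le_sum fun v _ => ?_
    have := hdeg v
    split_ifs with hv
    · simp only [T, Finset.mem_insert, Finset.mem_singleton] at hv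
      rcases hv with rfl | rfl | rfl <;> simp only at this <;> omega
    · have := h2 v; omega
  rw [Finset.sum_add_distrib, hsum, Finset.sum_boole] at hle
  simp only [Finset.filter_mem_eq_inter, Finset.univ_inter, hT, Finset.sum_const,
    Finset.card_univ, smul_eq_mul] at hle
  rw [Nat.card_eq_fintype_card, Nat.card_eq_fintype_card, ← edgeFinset_card] at hcard
  push_cast at hle
  omega

/-! ### Fans and the extension step of Vizing's theorem -/

namespace PartialEdgeColoring

variable {V α : Type*} {G : SimpleGraph V}

/-- One step of a fan at `w`: the colour of the edge `wu'` is missing at `u`, so that it could be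
passed on to the edge `wu`. -/
def FanStep (C : PartialEdgeColoring G α) (w u u' : V) : Prop :=
  ∃ z, C.Misses u z ∧ C.col z w u'

/-- The colours can be rearranged so that the edges coloured are those coloured by `C` together
with `wv`. -/
def Extendable (C : PartialEdgeColoring G α) (w v : V) : Prop :=
  ∃ C' : PartialEdgeColoring G α, ∀ x y, C'.Colored x y ↔ C.Colored x y ∨ s(x, y) = s(w, v)

lemma Misses.addEdge {C : PartialEdgeColoring G α} {a b u : V} {x z : α} (h : C.Misses u z)
    (hua : u ≠ a) (hub : u ≠ b) (hab : G.Adj a b) (hc : ¬ C.Colored a b) (ha : C.Misses a x)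
    (hb : C.Misses b x) : (C.addEdge hab hc ha hb).Misses u z := by
  rintro v (h' | ⟨-, h'⟩)
  · exact h v h'
  · rcases Sym2.eq_iff.1 h' with ⟨rfl, -⟩ | ⟨rfl, -⟩
    · exact hua rfl
    · exact hub rfl

lemma Misses.erase {C : PartialEdgeColoring G α} {u : V} {z : α} (h : C.Misses u z) (a b : V) :
    (C.erase a b).Misses u z :=
  fun v h' => h v h'.1

/-- Rotating a fan: if consecutive members of `p 0, …, p n` are related by a fan step at `w`, and
some colour is missing at both `w` and `p n`, then every edge `w (p i)` can hand its colour to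
its predecessor, and the uncoloured edge `w (p 0)` gets coloured. -/
lemma extendable_of_path {w : V} {a : α} (n : ℕ) :
    ∀ (C : PartialEdgeColoring G α) (p : ℕ → V), G.Adj w (p 0) → ¬ C.Colored w (p 0) →
      (∀ i < n, C.FanStep w (p i) (p (i + 1))) → C.Misses (p n) a → C.Misses w a →
      C.Extendable w (p 0) := by
  induction n using Nat.strong_induction_on with
  | _ n ih =>
  intro C p hadj hunc hstep hpa hwa
  by_cases hrep : ∃ i j, i < j ∧ j ≤ n ∧ p i = p j
  · -- Cut out the stretch between two equal members.
    obtain ⟨i, j, hij, hjn, hp⟩ := hrep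
    let q : ℕ → V := fun m => if m ≤ i then p m else p (m + (j - i))
    have hq0 : q 0 = p 0 := by simp [q]
    have key : C.Extendable w (q 0) := by
      refine ih (n - (j - i)) (by omega) C q (by rwa [hq0]) (by rwa [hq0]) ?_ ?_ hwa
      · intro m hm
        rcases lt_trichotomy m i with h | h | h
        · simpa [q, h.le, Nat.succ_le_of_lt h] using hstep m (by omega)
        · subst h
          have h1 := hstep j (by omega)
          have h2 : m + 1 + (j - m) = j + 1 := by omega
          simpa [q, hp, h2] using h1
        · have h1 := hstep (m + (j - i)) (by omega)
          have h2 : m + 1 + (j - i) = m + (j - i) + 1 := by omega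
          simpa [q, h.not_ge, show ¬ m + 1 ≤ i by omega, h2] using h1
      · by_cases h : n - (j - i) ≤ i
        · have h1 : n - (j - i) = i := by omega
          have h2 : j = n := by omega
          subst h2
          simpa only [q, h1, le_refl, if_true, hp] using hpa
        · have h1 : n - (j - i) + (j - i) = n := by omega
          simpa [q, h, h1] using hpa
    rwa [hq0] at key
  push Not at hrep
  cases n with
  | zero =>
    exact ⟨C.addEdge hadj hunc hwa hpa, C.colored_addEdge hadj hunc hwa hpa⟩
  | succ m =>
    -- Move the colour `z` of `w (p 1)` to `w (p 0)`, which leaves `w (p 1)` uncoloured.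
    obtain ⟨z, hz0, hz1⟩ := hstep 0 m.succ_pos
    have hne : ∀ i < m + 1, p (i + 1) ≠ p 0 := fun i hi =>
      (hrep 0 (i + 1) (by omega) (by omega)).symm
    have hnw : ∀ i < m + 1, p (i + 1) ≠ w := fun i hi => by
      obtain ⟨_, -, h⟩ := hstep i hi
      exact (C.adj h).ne'
    have e1 : ¬ (C.erase w (p 1)).Colored w (p 0) := fun ⟨y, h⟩ => hunc ⟨y, h.1⟩
    have e2 : (C.erase w (p 1)).Misses w z := fun v h => by
      have := C.proper h.1 hz1
      exact h.2 (by rw [this])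
    let C' := (C.erase w (p 1)).addEdge hadj e1 e2 (hz0.erase w (p 1))
    have hC' : ∀ x y, C'.Colored x y ↔
        (C.Colored x y ∧ s(x, y) ≠ s(w, p 1)) ∨ s(x, y) = s(w, p 0) := fun x y => by
      rw [colored_addEdge, colored_erase]
    have hext : C'.Extendable w (p (0 + 1)) := by
      refine ih m m.lt_succ_self C' (fun i => p (i + 1)) (C.adj hz1) ?_ ?_ ?_ ?_
      · rw [hC']
        rintro (h | h)
        · exact h.2 rfl
        · exact hne 0 m.succ_pos (Sym2.congr_right.1 h)
      · intro i hi
        obtain ⟨y, hy, hy'⟩ := hstep (i + 1) (by omega)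
        refine ⟨y, (hy.erase _ _).addEdge (hnw i (by omega)) (hne i (by omega)) _ _ _ _,
          Or.inl ⟨hy', fun h => ?_⟩⟩
        exact hrep 1 (i + 2) (by omega) (by omega) (Sym2.congr_right.1 h).symm
      · exact (hpa.erase _ _).addEdge (hnw m m.lt_succ_self) (hne m m.lt_succ_self) _ _ _ _
      · rintro v (h | ⟨rfl, -⟩)
        · exact hwa v h.1
        · exact hwa _ hz1
    obtain ⟨D, hD⟩ := hext
    refine ⟨D, fun x y => ?_⟩
    rw [hD, hC']
    have h1 : s(x, y) = s(w, p 1) → C.Colored x y := fun h => by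
      rcases Sym2.eq_iff.1 h with ⟨rfl, rfl⟩ | ⟨rfl, rfl⟩
      · exact ⟨z, hz1⟩
      · exact ⟨z, C.symm hz1⟩
    tauto

lemma extendable_of_reflTransGen {C : PartialEdgeColoring G α} {w v u : V} {a : α}
    (hadj : G.Adj w v) (hunc : ¬ C.Colored w v) (h : Relation.ReflTransGen (C.FanStep w) v u)
    (hu : C.Misses u a) (hw : C.Misses w a) : C.Extendable w v := by
  have : ∃ (n : ℕ) (p : ℕ → V), p 0 = v ∧ p n = u ∧ ∀ i < n, C.FanStep w (p i) (p (i + 1)) := by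
    clear hadj hunc hu
    induction h using Relation.ReflTransGen.head_induction_on with
    | refl => exact ⟨0, fun _ => u, rfl, rfl, by simp⟩
    | @head x y h _ ih =>
      obtain ⟨n, p, h0, hn, hp⟩ := ih
      refine ⟨n + 1, fun i => Nat.casesOn i x p, rfl, hn, fun i hi => ?_⟩
      cases i with
      | zero => simpa [h0] using h
      | succ i => exact hp i (by omega)
  obtain ⟨n, p, rfl, rfl, hp⟩ := this
  exact extendable_of_path n C p hadj hunc hp hu hw

lemma exists_misses [Finite V] [Fintype α] (C : PartialEdgeColoring G α) (u : V)
    (h : {v | C.Colored u v}.ncard < Fintype.card α) : ∃ z, C.Misses u z := by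
  by_contra! hne
  simp only [Misses, not_forall, not_not] at hne
  choose f hf using hne
  have hinj : Function.Injective f := fun y z h => C.unique (hf y) (h ▸ hf z)
  refine h.not_ge ?_
  rw [← Nat.card_eq_fintype_card, ← Set.ncard_univ, ← Set.ncard_image_of_injective _ hinj]
  refine Set.ncard_le_ncard ?_ (Set.toFinite _)
  rintro _ ⟨z, -, rfl⟩
  exact ⟨z, hf z⟩

/-- If a fan at `w` reaches `u`, some colour `b` is missing at `u`, some colour `a` is missing at
`w`, and the `a`-`b` Kempe chain of `u` avoids `w`, then the uncoloured edge can be coloured. After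
the two colours are interchanged on that chain, the fan either still reaches `u`, or it reaches an
earlier vertex at which `a` is missing now. -/
lemma extendable_of_not_reachable {C : PartialEdgeColoring G α} {w v u : V} {a b : α}
    (hadj : G.Adj w v) (hunc : ¬ C.Colored w v) (h : Relation.ReflTransGen (C.FanStep w) v u)
    (hu : C.Misses u b) (hw : C.Misses w a) (hr : ¬ (C.kempeGraph a b).Reachable u w) :
    C.Extendable w v := by
  classical
  let S : Set V := {x | (C.kempeGraph a b).Reachable u x}
  have hS : ∀ x y, C.col a x y ∨ C.col b x y → x ∈ S → y ∈ S := fun x y hxy hx =>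
    hx.trans (Adj.reachable (G := C.kempeGraph a b) hxy)
  let C' := C.swapOn a b S hS
  have hC' : ∀ x y, C'.Colored x y ↔ C.Colored x y := C.colored_swapOn a b S hS
  have hin : ∀ {x z}, x ∈ S → (C'.Misses x z ↔ C.Misses x (Equiv.swap a b z)) := fun {x z} hx => by
    simp [Misses, C', swapOn, hx]
  have hout : ∀ {x z y}, x ∉ S → (C'.col z x y ↔ C.col z x y) := fun {x z y} hx => by
    simp [C', swapOn, hx]
  have hwS : w ∉ S := hr
  have hw' : C'.Misses w a := fun y hy => hw y ((hout hwS).1 hy)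
  have key : ∀ x, Relation.ReflTransGen (C.FanStep w) v x →
      (∃ y, Relation.ReflTransGen (C'.FanStep w) v y ∧ C'.Misses y a) ∨
        Relation.ReflTransGen (C'.FanStep w) v x := by
    intro x hx
    induction hx with
    | refl => exact Or.inr .refl
    | @tail x x' _ hstep ih =>
      rcases ih with ih | ih
      · exact Or.inl ih
      obtain ⟨z, hz, hzw⟩ := hstep
      have hza : z ≠ a := by rintro rfl; exact hw _ hzw
      by_cases hxS : x ∈ S
      · by_cases hzb : z = b
        · subst hzb
          exact Or.inl ⟨x, ih, (hin hxS).2 (by simpa using hz)⟩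
        · refine Or.inr (ih.tail ⟨z, (hin hxS).2 ?_, (hout hwS).2 hzw⟩)
          rwa [Equiv.swap_apply_of_ne_of_ne hza hzb]
      · exact Or.inr (ih.tail ⟨z, fun y hy => hz y ((hout hxS).1 hy), (hout hwS).2 hzw⟩)
  have huS : u ∈ S := Reachable.refl u
  have hex : ∃ y, Relation.ReflTransGen (C'.FanStep w) v y ∧ C'.Misses y a :=
    (key u h).elim id fun h => ⟨u, h, (hin huS).2 (by simpa using hu)⟩
  obtain ⟨y, hy, hya⟩ := hex
  have hunc' : ¬ C'.Colored w v := by rwa [hC']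
  obtain ⟨D, hD⟩ := extendable_of_reflTransGen hadj hunc' hy hya hw'
  exact ⟨D, fun x y => by rw [hD, hC']⟩

/-- The extension step of Vizing's theorem: an uncoloured edge `wv` can be coloured if no degree
at `w` and `v` exceeds the number of colours and the other neighbours of `w` have smaller degree.
The fan at `w` consists of the vertices reachable from `v` by fan steps. If each colour missing at
one of them is present at `w`, then sending a vertex to the end of the edge at `w` with a colour
that the vertex misses maps the fan to itself without reaching `v`. So two fan vertices miss the
same colour `b`, and one of them lies on an `a`-`b` Kempe chain avoiding `w`, where `a` is missing
at `w`. -/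
theorem extendable_of_ncard_neighborSet [Finite V] [Fintype α] (C : PartialEdgeColoring G α)
    {w v : V} (hadj : G.Adj w v) (hw : (G.neighborSet w).ncard ≤ Fintype.card α)
    (hv : (G.neighborSet v).ncard ≤ Fintype.card α)
    (hn : ∀ u, G.Adj w u → u ≠ v → (G.neighborSet u).ncard < Fintype.card α)
    (hunc : ¬ C.Colored w v) : C.Extendable w v := by
  by_contra hext
  have hsub : ∀ u, {x | C.Colored u x} ⊆ G.neighborSet u := fun u x ⟨z, hz⟩ => C.adj hz
  obtain ⟨a, ha⟩ := C.exists_misses w <| (Set.ncard_lt_ncard (t := G.neighborSet w)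
    ⟨hsub w, fun h => hunc (h hadj)⟩ (Set.toFinite _)).trans_le hw
  have hmiss : ∀ u, Relation.ReflTransGen (C.FanStep w) v u → ∃ z, C.Misses u z := by
    intro u hu
    apply C.exists_misses
    by_cases huv : u = v
    · subst huv
      exact (Set.ncard_lt_ncard (t := G.neighborSet u)
        ⟨hsub u, fun h => hunc (h hadj.symm).symm⟩ (Set.toFinite _)).trans_le hv
    · obtain h | ⟨_, -, _, -, h⟩ := Relation.ReflTransGen.cases_tail hu
      · exact (huv h).elim
      · exact (Set.ncard_le_ncard (hsub u) (Set.toFinite _)).trans_lt (hn u (C.adj h) huv)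
  let F := {u // Relation.ReflTransGen (C.FanStep w) v u}
  choose z hz using fun u : F => hmiss u.1 u.2
  have hpres : ∀ u : F, ∃ y, C.col (z u) w y := fun u => by
    by_contra! h
    exact hext (extendable_of_reflTransGen hadj hunc u.2 (hz u) h)
  choose g hg using hpres
  let g' : F → F := fun u => ⟨g u, u.2.tail ⟨z u, hz u, hg u⟩⟩
  have hsurj : ¬ Function.Surjective g' := fun h => by
    obtain ⟨u, hu⟩ := h ⟨v, .refl⟩
    have : g u = v := congrArg Subtype.val hu
    exact hunc ⟨z u, this ▸ hg u⟩
  rw [← Finite.injective_iff_surjective] at hsurj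
  simp only [Function.Injective, not_forall] at hsurj
  obtain ⟨u, u', hgu, hne⟩ := hsurj
  have hgu : g u = g u' := congrArg Subtype.val hgu
  have hzz : z u = z u' := C.unique (hg u) (hgu ▸ hg u')
  have hFw : ∀ u : F, u.1 ≠ w := by
    rintro ⟨u, hu⟩
    obtain rfl | ⟨_, -, _, -, h⟩ := Relation.ReflTransGen.cases_tail hu
    · exact hadj.ne'
    · exact (C.adj h).ne'
  refine not_reachable_of_ncard_neighborSet_le (C.ncard_kempeGraph_neighborSet_le a (z u))
    (hFw u).symm (hFw u').symm (fun h => hne (Subtype.ext h))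
    (C.ncard_kempeGraph_neighborSet_le_of_misses _ _ _ (Or.inl ha))
    (C.ncard_kempeGraph_neighborSet_le_of_misses _ _ _ (Or.inr (hz u)))
    (C.ncard_kempeGraph_neighborSet_le_of_misses _ _ _ (Or.inr (hzz ▸ hz u'))) ⟨?_, ?_⟩
  · by_contra hr
    exact hext (extendable_of_not_reachable hadj hunc u.2 (hz u) ha fun h => hr h.symm)
  · by_contra hr
    exact hext (extendable_of_not_reachable hadj hunc u'.2 (hzz ▸ hz u') ha fun h => hr h.symm)

/-- A partial edge colouring extends to all edges if each uncoloured edge has an end that satisfies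
the degree conditions of the extension step. -/
theorem exists_forall_colored [Finite V] [Fintype α] (C : PartialEdgeColoring G α)
    (h : ∀ x y, G.Adj x y → ¬ C.Colored x y → ∃ w v, s(x, y) = s(w, v) ∧
      (G.neighborSet w).ncard ≤ Fintype.card α ∧ (G.neighborSet v).ncard ≤ Fintype.card α ∧
      ∀ u, G.Adj w u → u ≠ v → (G.neighborSet u).ncard < Fintype.card α) :
    ∃ C' : PartialEdgeColoring G α, ∀ x y, G.Adj x y → C'.Colored x y := by
  induction hn : {e : V × V | G.Adj e.1 e.2 ∧ ¬ C.Colored e.1 e.2}.ncard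
    using Nat.strong_induction_on generalizing C with
  | _ n ih =>
  by_cases hC : ∀ x y, G.Adj x y → C.Colored x y
  · exact ⟨C, hC⟩
  push Not at hC
  obtain ⟨x, y, hxy, hnc⟩ := hC
  obtain ⟨w, v, he, hw, hv, hnb⟩ := h x y hxy hnc
  have hwv : G.Adj w v := by rwa [← mem_edgeSet, ← he]
  have hnc' : ¬ C.Colored w v := by
    rcases Sym2.eq_iff.1 he with ⟨rfl, rfl⟩ | ⟨rfl, rfl⟩
    · exact hnc
    · exact fun h => hnc h.symm
  obtain ⟨D, hD⟩ := C.extendable_of_ncard_neighborSet hwv hw hv hnb hnc'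
  refine ih _ ?_ D (fun x y hxy hx => h x y hxy fun h => hx ((hD x y).2 (Or.inl h))) rfl
  rw [← hn]
  refine Set.ncard_lt_ncard ⟨fun e he => ⟨he.1, fun h => he.2 ((hD _ _).2 (Or.inl h))⟩,
    fun hsub => ?_⟩ (Set.toFinite _)
  exact (hsub (show (w, v) ∈ _ from ⟨hwv, hnc'⟩)).2 ((hD w v).2 (Or.inr rfl))

end PartialEdgeColoring

/-! ### Bounds for the chromatic index -/

variable {V W α : Type*} {G : SimpleGraph V}

lemma PartialEdgeColoring.chromaticIndex_le [Fintype α] (C : PartialEdgeColoring G α)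
    (hC : ∀ x y, G.Adj x y → C.Colored x y) : G.chromaticIndex ≤ Fintype.card α := by
  have hex : ∀ e : G.edgeSet, ∃ z, ∀ x y, s(x, y) = e.1 → C.col z x y := by
    rintro ⟨e, he⟩
    induction e with
    | _ x y =>
      obtain ⟨z, hz⟩ := hC x y he
      refine ⟨z, fun x' y' h => ?_⟩
      rcases Sym2.eq_iff.1 h with ⟨rfl, rfl⟩ | ⟨rfl, rfl⟩
      · exact hz
      · exact C.symm hz
  choose f hf using hex
  have hcol : G.lineGraph.Colorable (Fintype.card α) := by
    refine (Coloring.mk f fun {e e'} h he => ?_).colorable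
    obtain ⟨hne, v, hv, hv'⟩ := lineGraph_adj_iff_exists.1 h
    obtain ⟨y, hy⟩ := hv
    obtain ⟨y', hy'⟩ := hv'
    have h1 := hf e v y hy.symm
    have h2 := hf e' v y' hy'.symm
    rw [he] at h1
    have := C.proper h1 h2
    exact hne (Subtype.ext (by rw [hy, hy', this]))
  exact chromaticNumber_le_iff_colorable.2 hcol

/-- The edges at a vertex form a clique of the line graph. -/
lemma ncard_neighborSet_le_chromaticIndex (G : SimpleGraph V) (v : V) :
    ((G.neighborSet v).ncard : ℕ∞) ≤ G.chromaticIndex := by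
  refine le_chromaticNumber_iff_colorable.2 fun m hm => ?_
  have := hm.card_le_of_pairwise_adj
    (fun w : G.neighborSet v => (⟨s(v, w.1), w.2⟩ : G.edgeSet)) fun w w' hne =>
      lineGraph_adj_iff_exists.2 ⟨fun h => hne (Subtype.ext
        (Sym2.congr_right.1 (Subtype.mk.inj h))), v, Sym2.mem_mk_left _ _, Sym2.mem_mk_left _ _⟩
  rw [Nat.card_coe_set_eq] at this
  exact_mod_cast this

lemma Copy.chromaticIndex_le {H : SimpleGraph W} (f : Copy G H) :
    G.chromaticIndex ≤ H.chromaticIndex :=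
  chromaticNumber_mono_of_hom f.lineGraph.toHom

/-- Removing no vertex never changes the chromatic index, so the stability number is one as soon as
the removal of a single vertex lowers the chromatic index. -/
lemma vertexStabilityChromaticIndex_eq_one [Fintype V] (v : V)
    (h : (G.induce {u | u ≠ v}).chromaticIndex < G.chromaticIndex) :
    G.vertexStabilityChromaticIndex = 1 := by
  classical
  have hG : G ≠ ⊥ := by
    rintro rfl
    have h0 : (⊥ : SimpleGraph V).chromaticIndex ≤ 0 := by
      let C : PartialEdgeColoring (⊥ : SimpleGraph V) Empty :=
        ⟨fun _ _ _ => False, id, False.elim, fun h => h.elim, fun h => h.elim⟩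
      simpa using C.chromaticIndex_le fun x y h => h.elim
    exact (h.trans_le h0).not_ge zero_le
  have hmem : 1 ∈ {k : ℕ | ∃ S : Finset V, S.card = k ∧
      (G.induce {v : V | v ∉ S}).chromaticIndex ≠ G.chromaticIndex} := by
    refine ⟨{v}, Finset.card_singleton v, ?_⟩
    have : {u : V | u ∉ ({v} : Finset V)} = {u | u ≠ v} := by ext; simp
    rw [this]
    exact h.ne
  rw [vertexStabilityChromaticIndex, if_neg hG]
  refine le_antisymm (Nat.sInf_le hmem) (Nat.one_le_iff_ne_zero.2 fun h0 => ?_)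
  have := Nat.sInf_mem ⟨1, hmem⟩
  rw [h0] at this
  obtain ⟨S, hS, hne⟩ := this
  obtain rfl := Finset.card_eq_zero.1 hS
  have huniv : {u : V | u ∉ (∅ : Finset V)} = Set.univ := by ext; simp
  rw [huniv] at hne
  exact hne (le_antisymm (Copy.chromaticIndex_le (induceUnivIso G).toCopy)
    (Copy.chromaticIndex_le (induceUnivIso G).symm.toCopy))

/-! ### Edge colourings of joins -/

variable {V₁ V₂ : Type*} {G₁ : SimpleGraph V₁} {G₂ : SimpleGraph V₂}

/-- The disjoint union of `G₁` and `G₂` together with the matching that joins each vertex `a` of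
`G₁` to the vertex `f a` of `G₂`. -/
def matchedSum (G₁ : SimpleGraph V₁) (G₂ : SimpleGraph V₂) (f : V₁ ↪ V₂) :
    SimpleGraph (V₁ ⊕ V₂) where
  Adj
    | .inl a, .inl a' => G₁.Adj a a'
    | .inr b, .inr b' => G₂.Adj b b'
    | .inl a, .inr b => f a = b
    | .inr b, .inl a => f a = b
  symm := ⟨by rintro (a | b) (a' | b') h <;> first | exact h | exact h.symm⟩
  loopless := ⟨by rintro (a | b) h <;> exact h.ne rfl⟩

lemma sum_le_matchedSum (f : V₁ ↪ V₂) : (G₁ ⊕g G₂) ≤ matchedSum G₁ G₂ f := by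
  rintro (a | b) (a' | b') h <;> first | exact h | simp at h

lemma ncard_sum_neighborSet_inl (a : V₁) :
    ((G₁ ⊕g G₂).neighborSet (.inl a)).ncard = (G₁.neighborSet a).ncard := by
  rw [← Set.ncard_image_of_injective _ (Sum.inl_injective (α := V₁) (β := V₂))]
  congr 1
  ext (x | x) <;> simp

lemma ncard_sum_neighborSet_inr (b : V₂) :
    ((G₁ ⊕g G₂).neighborSet (.inr b)).ncard = (G₂.neighborSet b).ncard := by
  rw [← Set.ncard_image_of_injective _ (Sum.inr_injective (α := V₁) (β := V₂))]
  congr 1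
  ext (x | x) <;> simp

lemma ncard_matchedSum_neighborSet_le [Finite V₁] [Finite V₂] (f : V₁ ↪ V₂) (x : V₁ ⊕ V₂) :
    ((matchedSum G₁ G₂ f).neighborSet x).ncard ≤ ((G₁ ⊕g G₂).neighborSet x).ncard + 1 := by
  have h1 : ({y | y ∈ (matchedSum G₁ G₂ f).neighborSet x ∧
      y ∉ (G₁ ⊕g G₂).neighborSet x}).ncard ≤ 1 := by
    refine (Set.ncard_le_one_iff (Set.toFinite _)).2 fun {y y'} h h' => ?_
    rcases x with a | b <;> rcases y with y | y <;> rcases y' with y' | y' <;>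
      simp only [Set.mem_ofPred_eq, mem_neighborSet, matchedSum, sum_adj_inl, sum_adj_inr,
        and_not_self] at h h'
    · rw [← h.1, ← h'.1]
    · rw [f.injective (h.1.trans h'.1.symm)]
  refine (Set.ncard_le_ncard ?_ (Set.toFinite _)).trans
    ((Set.ncard_union_le _ _).trans (Nat.add_le_add_left h1 _))
  intro y hy
  by_cases h : y ∈ (G₁ ⊕g G₂).neighborSet x
  · exact Or.inl h
  · exact Or.inr ⟨hy, h⟩

/-- Here `d + 1` colours suffice although `d + 1` may be the maximum degree: a matching edge is
coloured last, by means of a fan at its end in `G₂`, all of whose other neighbours have degree at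
most `d`. -/
lemma exists_edgeColoring_matchedSum [Finite V₁] [Finite V₂] (f : V₁ ↪ V₂) {d : ℕ}
    (h₁ : ∀ a, (G₁.neighborSet a).ncard ≤ d) (h₂ : ∀ b, (G₂.neighborSet b).ncard < d) :
    ∃ C : PartialEdgeColoring (matchedSum G₁ G₂ f) (Fin (d + 1)),
      ∀ x y, (matchedSum G₁ G₂ f).Adj x y → C.Colored x y := by
  have hs : ∀ x, ((G₁ ⊕g G₂).neighborSet x).ncard ≤ d := by
    rintro (a | b)
    · rw [ncard_sum_neighborSet_inl]; exact h₁ a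
    · rw [ncard_sum_neighborSet_inr]; exact (h₂ b).le
  have hm : ∀ x, ((matchedSum G₁ G₂ f).neighborSet x).ncard ≤ d + 1 := fun x =>
    (ncard_matchedSum_neighborSet_le f x).trans (Nat.add_le_add_right (hs x) 1)
  have hr : ∀ b, ((matchedSum G₁ G₂ f).neighborSet (.inr b)).ncard < d + 1 := fun b =>
    (ncard_matchedSum_neighborSet_le f _).trans_lt
      (Nat.add_lt_add_right (by rw [ncard_sum_neighborSet_inr]; exact h₂ b) 1)
  let E : PartialEdgeColoring (G₁ ⊕g G₂) (Fin (d + 1)) :=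
    ⟨fun _ _ _ => False, id, False.elim, fun h => h.elim, fun h => h.elim⟩
  obtain ⟨D, hD⟩ := E.exists_forall_colored fun x y _ _ => ⟨x, y, rfl, by
    simpa using Nat.le_succ_of_le (hs x), by simpa using Nat.le_succ_of_le (hs y),
    fun u _ _ => by simpa using Nat.lt_succ_of_le (hs u)⟩
  let D' : PartialEdgeColoring (matchedSum G₁ G₂ f) (Fin (d + 1)) :=
    ⟨D.col, D.symm, fun h => sum_le_matchedSum f (D.adj h), D.unique, D.proper⟩
  refine D'.exists_forall_colored ?_
  have key : ∀ a b, (matchedSum G₁ G₂ f).Adj (.inl a) (.inr b) →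
      ∀ u, (matchedSum G₁ G₂ f).Adj (.inr b) u → u ≠ .inl a →
        ((matchedSum G₁ G₂ f).neighborSet u).ncard < d + 1 := by
    rintro a b h (a' | b') h' hne
    · exact (hne (congrArg _ (f.injective (Eq.trans h' (Eq.symm h))))).elim
    · exact hr b'
  simp only [Fintype.card_fin]
  rintro (a | b) (a' | b') h hnc
  · exact (hnc (hD _ _ (sum_adj_inl.2 h))).elim
  · exact ⟨_, _, Sym2.eq_swap, hm _, hm _, key a b' h⟩
  · exact ⟨_, _, rfl, hm _, hm _, key a' b h⟩
  · exact (hnc (hD _ _ (sum_adj_inr.2 h))).elim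

/-- Number the vertices of `G₁` and `G₂` by distinct elements of `ZMod m`, where `m` is the order
of `G₂`, and colour an edge between `a` and `b` by the difference of their numbers. The edges with
difference zero form a matching that covers `G₁`; together with `G₁` and `G₂` they need `d + 1`
colours, and `m - 1` colours remain for the other differences. -/
theorem chromaticIndex_graphJoin_le [Fintype V₁] [Fintype V₂] {d : ℕ}
    (h₁ : ∀ a, (G₁.neighborSet a).ncard ≤ d) (h₂ : ∀ b, (G₂.neighborSet b).ncard < d)
    (hcard : Fintype.card V₁ ≤ Fintype.card V₂) (hpos : 0 < Fintype.card V₂) :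
    (G₁.graphJoin G₂).chromaticIndex ≤ (d + Fintype.card V₂ : ℕ) := by
  classical
  have : NeZero (Fintype.card V₂) := ⟨hpos.ne'⟩
  let e₂ : V₂ ≃ ZMod (Fintype.card V₂) := Fintype.equivOfCardEq (ZMod.card _).symm
  obtain ⟨e₁⟩ : Nonempty (V₁ ↪ ZMod (Fintype.card V₂)) :=
    Function.Embedding.nonempty_of_card_le (by rwa [ZMod.card])
  let f : V₁ ↪ V₂ := e₁.trans e₂.symm.toEmbedding
  have hf : ∀ {a b}, f a = b ↔ e₂ b - e₁ a = 0 := fun {a b} => by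
    rw [sub_eq_zero, eq_comm (a := e₂ b), ← Equiv.symm_apply_eq]; rfl
  obtain ⟨C, hC⟩ := exists_edgeColoring_matchedSum f h₁ h₂
  let cross : {z : ZMod (Fintype.card V₂) // z ≠ 0} → V₁ ⊕ V₂ → V₁ ⊕ V₂ → Prop := fun z x y =>
    match x, y with
    | .inl a, .inr b => e₂ b - e₁ a = z
    | .inr b, .inl a => e₂ b - e₁ a = z
    | _, _ => False
  have hcross : ∀ {z x y}, cross z x y → ¬ (matchedSum G₁ G₂ f).Adj x y := by
    rintro z (a | b) (a' | b') h h'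
    · exact h
    · exact z.2 (Eq.trans (Eq.symm h) (hf.1 h'))
    · exact z.2 (Eq.trans (Eq.symm h) (hf.1 h'))
    · exact h
  let D : PartialEdgeColoring (G₁.graphJoin G₂)
      (Fin (d + 1) ⊕ {z : ZMod (Fintype.card V₂) // z ≠ 0}) :=
    { col := fun z x y => Sum.elim (fun z => C.col z x y) (fun z => cross z x y) z
      symm := by
        rintro (z | z) x y h
        · exact C.symm h
        · rcases x with a | b <;> rcases y with a' | b' <;> exact h
      adj := by
        rintro (z | z) (a | b) (a' | b') h
        · simpa [graphJoin] using (show G₁.Adj a a' from C.adj h)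
        · simp [graphJoin]
        · simp [graphJoin]
        · simpa [graphJoin] using (show G₂.Adj b b' from C.adj h)
        · exact h.elim
        · simp [graphJoin]
        · simp [graphJoin]
        · exact h.elim
      unique := by
        rintro (y | y) (z | z) u v h h'
        · exact congrArg _ (C.unique h h')
        · exact (hcross h' (C.adj h)).elim
        · exact (hcross h (C.adj h')).elim
        · rcases u with a | b <;> rcases v with a' | b'
          · exact h.elim
          · exact congrArg _ (Subtype.ext (Eq.trans (Eq.symm h) h'))
          · exact congrArg _ (Subtype.ext (Eq.trans (Eq.symm h) h'))
          · exact h.elim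
      proper := by
        rintro (z | z) u v v' h h'
        · exact C.proper h h'
        · rcases u with a | b <;> rcases v with c | c <;> rcases v' with c' | c'
          · exact h.elim
          · exact h.elim
          · exact h'.elim
          · exact congrArg _ (e₂.injective (sub_left_injective (Eq.trans h (Eq.symm h'))))
          · exact congrArg _ (e₁.injective (sub_right_injective (Eq.trans h (Eq.symm h'))))
          · exact h'.elim
          · exact h.elim
          · exact h.elim }
  have hD : ∀ x y, (G₁.graphJoin G₂).Adj x y → D.Colored x y := by
    intro x y h
    by_cases hm : (matchedSum G₁ G₂ f).Adj x y
    · obtain ⟨z, hz⟩ := hC x y hm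
      exact ⟨.inl z, hz⟩
    · rcases x with a | b <;> rcases y with a' | b'
      · exact (hm (show G₁.Adj a a' by simpa [graphJoin] using h)).elim
      · exact ⟨.inr ⟨_, fun h0 => hm (hf.2 h0)⟩, rfl⟩
      · exact ⟨.inr ⟨_, fun h0 => hm (hf.2 h0)⟩, rfl⟩
      · exact (hm (show G₂.Adj b b' by simpa [graphJoin] using h)).elim
  refine (D.chromaticIndex_le hD).trans (Nat.cast_le.2 ?_)
  rw [Fintype.card_sum, Fintype.card_fin, Fintype.card_subtype_compl, ZMod.card,
    Fintype.card_subtype_eq]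
  omega

lemma le_chromaticIndex_graphJoin [Finite V₁] [Fintype V₂] (a : V₁) :
    (((G₁.neighborSet a).ncard + Fintype.card V₂ : ℕ) : ℕ∞) ≤
      (G₁.graphJoin G₂).chromaticIndex := by
  refine le_trans (Nat.cast_le.2 ?_) (ncard_neighborSet_le_chromaticIndex _ (.inl a))
  have h : (G₁.graphJoin G₂).neighborSet (.inl a) = Sum.inl '' G₁.neighborSet a ∪
      Sum.inr '' (Set.univ : Set V₂) := by
    ext (x | x) <;> simp [graphJoin]
  rw [h, Set.ncard_union_eq ?_ (Set.toFinite _) (Set.toFinite _),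
    Set.ncard_image_of_injective _ Sum.inl_injective,
    Set.ncard_image_of_injective _ Sum.inr_injective, Set.ncard_univ, Nat.card_eq_fintype_card]
  rw [Set.disjoint_left]
  rintro _ ⟨x, -, rfl⟩ ⟨y, -, h⟩
  cases h

/-- The join is given only up to isomorphism, so that its two factors can be exchanged. -/
theorem vertexStabilityChromaticIndex_eq_one_of_iso_graphJoin [Fintype V] [Fintype V₁]
    [Fintype V₂] [DecidableRel G₁.Adj] [DecidableRel G₂.Adj] (e : G ≃g G₁.graphJoin G₂)
    (hcard : Fintype.card V₁ + 1 ≤ Fintype.card V₂) (hdeg : G₂.maxDegree < G₁.maxDegree) :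
    G.vertexStabilityChromaticIndex = 1 := by
  classical
  have hd₁ : ∀ a, (G₁.neighborSet a).ncard = G₁.degree a := fun a => by
    rw [← card_neighborSet_eq_degree, ← Nat.card_eq_fintype_card, Nat.card_coe_set_eq]
  have hd₂ : ∀ b, (G₂.neighborSet b).ncard = G₂.degree b := fun b => by
    rw [← card_neighborSet_eq_degree, ← Nat.card_eq_fintype_card, Nat.card_coe_set_eq]
  have : Nonempty V₁ := by
    by_contra hemp
    rw [not_nonempty_iff] at hemp
    simp at hdeg
  obtain ⟨a, ha⟩ := G₁.exists_maximal_degree_vertex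
  have hpos₁ : 0 < Fintype.card V₁ := Fintype.card_pos
  obtain ⟨v⟩ : Nonempty V₂ := Fintype.card_pos_iff.1 (by omega)
  -- The chromatic index drops when any vertex of the larger factor is removed.
  refine vertexStabilityChromaticIndex_eq_one (e.symm (.inr v)) ?_
  let W : Set V₂ := {x | x ≠ v}
  have hW : Fintype.card W + 1 = Fintype.card V₂ := by
    have : Fintype.card W = Fintype.card V₂ - 1 := Set.card_ne_eq v
    omega
  have hupper := chromaticIndex_graphJoin_le (G₁ := G₁) (G₂ := G₂.induce W) (d := G₁.maxDegree)
    (fun a => hd₁ a ▸ G₁.degree_le_maxDegree a) (fun b => by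
      refine lt_of_le_of_lt ?_ hdeg
      refine le_trans ?_ ((hd₂ b.1).le.trans (G₂.degree_le_maxDegree b.1))
      exact Set.ncard_le_ncard_of_injOn Subtype.val (fun x hx => hx)
        Subtype.val_injective.injOn (Set.toFinite _)) (by omega) (by omega)
  have hlower := (le_chromaticIndex_graphJoin (G₁ := G₁) (G₂ := G₂) a).trans
    (Copy.chromaticIndex_le e.symm.toCopy)
  rw [hd₁, ← ha] at hlower
  have hlift : ∀ u : {u | u ≠ e.symm (.inr v)}, ∃ y : V₁ ⊕ W, Sum.map id Subtype.val y = e u := by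
    rintro ⟨u, hu⟩
    rcases hx : e u with x | x
    · exact ⟨.inl x, rfl⟩
    · exact ⟨.inr ⟨x, fun h => hu (by rw [← h, ← hx]; simp)⟩, rfl⟩
  choose g hg using hlift
  have hadj : ∀ y y' : V₁ ⊕ W, (G₁.graphJoin G₂).Adj (Sum.map id Subtype.val y)
      (Sum.map id Subtype.val y') → (G₁.graphJoin (G₂.induce W)).Adj y y' := by
    rintro (y | y) (y' | y') h <;> simp_all [graphJoin]
  let f : Copy (G.induce {u | u ≠ e.symm (.inr v)}) (G₁.graphJoin (G₂.induce W)) :=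
    ⟨⟨g, fun {u u'} h => hadj _ _ (by rw [hg, hg]; exact e.map_adj_iff.2 h)⟩, fun u u' h =>
      Subtype.ext (e.injective (by rw [← hg, ← hg]; exact congrArg _ h))⟩
  refine (f.chromaticIndex_le.trans hupper).trans_lt (lt_of_lt_of_le ?_ hlower)
  exact Nat.cast_lt.2 (by omega)

/-- The join is commutative. -/
def graphJoinComm (G₁ : SimpleGraph V₁) (G₂ : SimpleGraph V₂) :
    G₁.graphJoin G₂ ≃g G₂.graphJoin G₁ where
  toEquiv := Equiv.sumComm V₁ V₂
  map_rel_iff' := by rintro (x | x) (y | y) <;> simp [graphJoin]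

end SimpleGraph

theorem mainTheorem12 {V₁ V₂ : Type*} [Fintype V₁] [Fintype V₂]
    (G₁ : SimpleGraph V₁) (G₂ : SimpleGraph V₂)
    [DecidableRel G₁.Adj] [DecidableRel G₂.Adj] :
    (Fintype.card V₁ + 1 ≤ Fintype.card V₂ → G₂.maxDegree < G₁.maxDegree →
      (G₁.graphJoin G₂).vertexStabilityChromaticIndex = 1) ∧
    (Fintype.card V₁ = Fintype.card V₂ + 1 → G₁.maxDegree < G₂.maxDegree →
      (G₁.graphJoin G₂).vertexStabilityChromaticIndex = 1) :=
  ⟨SimpleGraph.vertexStabilityChromaticIndex_eq_one_of_iso_graphJoin SimpleGraph.Iso.refl,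
    fun h => SimpleGraph.vertexStabilityChromaticIndex_eq_one_of_iso_graphJoin
      (SimpleGraph.graphJoinComm G₁ G₂) h.ge⟩
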